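/- For a positive integer $n$, let $L_n$ be the set of partitions $\alpha=(a_1\ge a_2\ge\cdots\ge a_n\ge 0)$, $a_1+\cdots+a_n=n$, of $n$ (with $a_i=0$ for $i>n$), ordered by dominance: $\alpha\ge\beta$ if and only if $\sum_{i=1}^{j}a_i\ge\sum_{i=1}^{j}b_i$ for all $j\ge 1$. This is a lattice. An element $a$ of a lattice is join-irreducible if it is not the minimum element and $a=b\vee c$ implies $a=b$ or $a=c$; dually, it is meet-irreducible if it is not the maximum element and $a=b\wedge c$ implies $a=b$ or $a=c$. Let $J(L_n)$ and $M(L_n)$ denote the sets of join-irreducible and of meet-irreducible elements of $L_n$. The conjugate $\alpha^*$ of $\alpha$ is the partition of $n$ whose $j$-th part is the number of $i$ with $a_i\ge j$. Theorem. (1) $|J(L_1)|=0$, and for every $n\ge 1$, $$|J(L_{n+1})|=|J(L_n)|+\left\lfloor \frac n3\right\rfloor+1 .$$ (2) For every $n\ge 1$, conjugation $\alpha\mapsto\alpha^*$ is a bijection of $L_n$ onto itself, and $\alpha^*\le\beta^*$ if and only if $\beta\le\alpha$; that is, $L_n$ is self-dual under conjugation. (3) The same recursion holds for the meet-irreducible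 elements: $|M(L_1)|=0$, and for every $n\ge 1$, $$|M(L_{n+1})|=|M(L_n)|+\left\lfloor \frac n3\right\rfloor+1 .$$ -/

import Mathlib

namespace Nat.Partition

variable {n : ℕ}

/-- The `i`-th largest part `a_{i+1}` of the partition `a_1 ≥ a_2 ≥ ⋯ ≥ a_k > 0` (counted from
`i = 0`), with `0` in all positions `i ≥ k`. -/
def nthPart (p : n.Partition) (i : ℕ) : ℕ :=
  (p.parts.sort (· ≥ ·)).getD i 0

/-- The sum `a_1 + ⋯ + a_j` of the `j` largest parts. -/
def partialSum (p : n.Partition) (j : ℕ) : ℕ :=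
  ∑ i ∈ Finset.range j, p.nthPart i

/-- The dominance ordering: `p ≤ q` if and only if every partial sum of `p` is at most the
corresponding partial sum of `q`. -/
instance instLEDominance : LE n.Partition where
  le p q := ∀ j, p.partialSum j ≤ q.partialSum j

theorem dominance_le_iff {p q : n.Partition} :
    p ≤ q ↔ ∀ j, p.partialSum j ≤ q.partialSum j := Iff.rfl

/-! ### Facts needed to see that the dominance ordering is a lattice ordering -/

theorem partialSum_succ (p : n.Partition) (j : ℕ) :
    p.partialSum (j + 1) = p.partialSum j + p.nthPart j :=
  Finset.sum_range_succ _ _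

theorem partialSum_zero (p : n.Partition) : p.partialSum 0 = 0 := rfl

theorem nthPart_antitone (p : n.Partition) : Antitone p.nthPart := by
  refine antitone_nat_of_succ_le fun i => ?_
  unfold nthPart
  have h := Multiset.pairwise_sort p.parts (· ≥ ·)
  by_cases hi : i + 1 < (p.parts.sort (· ≥ ·)).length
  · rw [List.getD_eq_getElem _ _ hi, List.getD_eq_getElem _ _ (by omega)]
    exact List.pairwise_iff_getElem.1 h i (i + 1) (by omega) hi (by omega)
  · rw [List.getD_eq_default _ _ (by omega)]
    exact Nat.zero_le _

theorem partialSum_eq_take (p : n.Partition) (j : ℕ) :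
    p.partialSum j = ((p.parts.sort (· ≥ ·)).take j).sum := by
  induction j with
  | zero => simp [partialSum]
  | succ j ih =>
    rw [partialSum_succ, ih, nthPart]
    by_cases hj : j < (p.parts.sort (· ≥ ·)).length
    · rw [List.getD_eq_getElem _ _ hj, List.sum_take_succ _ _ hj]
    · rw [List.getD_eq_default _ _ (by omega), List.take_of_length_le (by omega),
        List.take_of_length_le (by omega), add_zero]

theorem card_parts_le (p : n.Partition) : p.parts.card ≤ n := by
  have h := Multiset.card_nsmul_le_sum (s := p.parts) (a := 1) (fun x hx => p.parts_pos hx)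
  simpa [p.parts_sum] using h

theorem partialSum_of_le (p : n.Partition) {j : ℕ} (hj : n ≤ j) : p.partialSum j = n := by
  have hlen : (p.parts.sort (· ≥ ·)).length ≤ j := by
    rw [Multiset.length_sort]
    exact p.card_parts_le.trans hj
  rw [partialSum_eq_take, List.take_of_length_le hlen, ← Multiset.sum_coe, Multiset.sort_eq,
    p.parts_sum]

theorem partialSum_mono (p : n.Partition) : Monotone p.partialSum :=
  monotone_nat_of_le_succ fun j => by rw [partialSum_succ]; omega

theorem partialSum_le (p : n.Partition) (j : ℕ) : p.partialSum j ≤ n :=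
  (p.partialSum_mono (le_max_left j n)).trans (p.partialSum_of_le (le_max_right j n)).le

theorem nthPart_pos_iff (p : n.Partition) (i : ℕ) : 0 < p.nthPart i ↔ i < p.parts.card := by
  unfold nthPart
  rw [← Multiset.length_sort (s := p.parts) (r := (· ≥ ·))]
  by_cases hi : i < (p.parts.sort (· ≥ ·)).length
  · rw [List.getD_eq_getElem _ _ hi]
    exact iff_of_true (p.parts_pos ((Multiset.mem_sort _).1 (List.getElem_mem hi))) hi
  · rw [List.getD_eq_default _ _ (by omega)]
    omega

theorem nthPart_injective {p q : n.Partition} (h : ∀ i, p.nthPart i = q.nthPart i) : p = q := by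
  have hcard : p.parts.card = q.parts.card := by
    refine le_antisymm ?_ ?_ <;> by_contra! hlt
    · have := (p.nthPart_pos_iff _).2 hlt
      rw [h, nthPart_pos_iff] at this
      omega
    · have := (q.nthPart_pos_iff _).2 hlt
      rw [← h, nthPart_pos_iff] at this
      omega
  have hsort : p.parts.sort (· ≥ ·) = q.parts.sort (· ≥ ·) := by
    refine List.ext_getElem (by simpa using hcard) fun i h₁ h₂ => ?_
    have := h i
    unfold nthPart at this
    rwa [List.getD_eq_getElem _ _ h₁, List.getD_eq_getElem _ _ h₂] at this
  apply Nat.Partition.ext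
  rw [← Multiset.sort_eq p.parts (· ≥ ·), hsort, Multiset.sort_eq]

/-- The partition of `n` with prescribed weakly decreasing parts `f 0 ≥ f 1 ≥ ⋯`. -/
def ofFun (n : ℕ) (f : ℕ → ℕ) (hsum : ∑ i ∈ Finset.range n, f i = n) : n.Partition :=
  ofSums n ((Multiset.range n).map f) hsum

theorem nthPart_ofFun (f : ℕ → ℕ) (hsum : ∑ i ∈ Finset.range n, f i = n) (hf : Antitone f)
    (hfn : f n = 0) (i : ℕ) : (ofFun n f hsum).nthPart i = f i := by
  obtain ⟨k, hk⟩ : ∃ k, ∀ i, i < k ↔ f i ≠ 0 := by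
    classical
    have hex : ∃ m, f m = 0 := ⟨n, hfn⟩
    refine ⟨Nat.find hex, fun i => ?_⟩
    rw [Nat.lt_find_iff]
    refine ⟨fun h => h i le_rfl, fun h m hm h0 => h ?_⟩
    have := hf hm
    omega
  have hkn : k ≤ n := by
    by_contra! h
    exact (hk n).1 h hfn
  have hparts : (ofFun n f hsum).parts = ((List.range k).map f : List ℕ) := by
    change Multiset.filter (· ≠ 0) ((Multiset.range n).map f) = _
    rw [Multiset.filter_map, ← Multiset.map_coe]
    congr 1
    have hfilter : Multiset.filter ((fun x => x ≠ 0) ∘ f) (Multiset.range n)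
        = Multiset.filter (fun x => x < k) (Multiset.range n) :=
      Multiset.filter_congr fun x _ => (hk x).symm
    rw [hfilter]
    refine (Multiset.Nodup.ext ((Multiset.nodup_range n).filter _)
      (Multiset.nodup_range k)).2 fun x => ?_
    rw [Multiset.mem_filter, Multiset.mem_range, Multiset.mem_range]
    omega
  have hsorted : ((List.range k).map f).Pairwise (· ≥ ·) := by
    rw [List.pairwise_map]
    exact List.pairwise_lt_range.imp fun h => hf h.le
  have hsort : (ofFun n f hsum).parts.sort (· ≥ ·) = (List.range k).map f := by
    rw [hparts, Multiset.coe_sort]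
    exact List.mergeSort_of_pairwise (by simpa using hsorted)
  rw [nthPart, hsort]
  by_cases hi : i < k
  · rw [List.getD_eq_getElem _ _ (by simpa using hi)]
    simp
  · rw [List.getD_eq_default _ _ (by simpa using hi)]
    by_contra h
    exact hi ((hk i).2 (Ne.symm h))

/-- The infimum of two partitions: its partial sums are the pointwise minima. -/
theorem exists_partialSum_eq_min (p q : n.Partition) :
    ∃ r : n.Partition, ∀ j, r.partialSum j = min (p.partialSum j) (q.partialSum j) := by
  set F : ℕ → ℕ := fun j => min (p.partialSum j) (q.partialSum j) with hF
  have hmono : Monotone F := fun i j h => min_le_min (p.partialSum_mono h) (q.partialSum_mono h)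
  have hsum : ∀ j, ∑ i ∈ Finset.range j, (F (i + 1) - F i) = F j := fun j => by
    rw [Finset.sum_range_tsub hmono]
    simp [hF, partialSum_zero]
  have hn : ∀ j, n ≤ j → F j = n := fun j hj => by
    simp [hF, partialSum_of_le _ hj]
  have hanti : Antitone fun i => F (i + 1) - F i := by
    refine antitone_nat_of_succ_le fun i => ?_
    have hp := p.nthPart_antitone (Nat.le_succ i)
    have hq := q.nthPart_antitone (Nat.le_succ i)
    simp only [hF, partialSum_succ, Nat.succ_eq_add_one] at hp hq ⊢
    omega
  refine ⟨ofFun n (fun i => F (i + 1) - F i) ((hsum n).trans (hn n le_rfl)), fun j => ?_⟩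
  have hzero : F (n + 1) - F n = 0 := by
    rw [hn n le_rfl, hn (n + 1) (Nat.le_succ n), Nat.sub_self]
  rw [partialSum, Finset.sum_congr rfl fun i _ => nthPart_ofFun _ _ hanti hzero i]
  exact hsum j

theorem dominance_le_indiscrete (p : n.Partition) : p ≤ indiscrete n := by
  intro j
  rcases Nat.eq_zero_or_pos j with rfl | hj
  · simp [partialSum_zero]
  rcases Nat.eq_zero_or_pos n with rfl | hn
  · rw [Subsingleton.elim p (indiscrete 0)]
  refine (p.partialSum_le j).trans ?_
  rw [partialSum_eq_take, indiscrete_parts hn.ne', Multiset.sort_singleton,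
    List.take_of_length_le (by rw [List.length_singleton]; omega)]
  simp

instance instPartialOrderDominance : PartialOrder n.Partition where
  le_refl _ _ := le_rfl
  le_trans _ _ _ h₁ h₂ j := (h₁ j).trans (h₂ j)
  le_antisymm p q h₁ h₂ := nthPart_injective fun i => by
    have e : ∀ j, p.partialSum j = q.partialSum j := fun j => le_antisymm (h₁ j) (h₂ j)
    have := e (i + 1)
    rw [partialSum_succ, partialSum_succ, e i] at this
    omega

/-- The lattice `L_n` of partitions of `n` under the dominance ordering. The supremum of `p` and `q`
is obtained as the infimum of the finitely many common upper bounds of `p` and `q`. -/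
noncomputable instance instLatticeDominance : Lattice n.Partition :=
  letI si : SemilatticeInf n.Partition :=
    { instPartialOrderDominance with
      inf := fun p q => (exists_partialSum_eq_min p q).choose
      inf_le_left := fun p q j => by
        rw [(exists_partialSum_eq_min p q).choose_spec]; exact min_le_left _ _
      inf_le_right := fun p q j => by
        rw [(exists_partialSum_eq_min p q).choose_spec]; exact min_le_right _ _
      le_inf := fun r p q h₁ h₂ j => by
        rw [(exists_partialSum_eq_min p q).choose_spec]; exact le_min (h₁ j) (h₂ j) }
  letI ot : OrderTop n.Partition :=
    { top := indiscrete n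
      le_top := dominance_le_indiscrete }
  letI (p q : n.Partition) : DecidablePred fun r : n.Partition => p ≤ r ∧ q ≤ r :=
    Classical.decPred _
  { si with
    sup := fun p q => (Finset.univ.filter fun r : n.Partition => p ≤ r ∧ q ≤ r).inf id
    le_sup_left := fun _ _ => Finset.le_inf fun _ hr => (Finset.mem_filter.1 hr).2.1
    le_sup_right := fun _ _ => Finset.le_inf fun _ hr => (Finset.mem_filter.1 hr).2.2
    sup_le := fun _ _ r h₁ h₂ =>
      Finset.inf_le (f := id) (Finset.mem_filter.2 ⟨Finset.mem_univ r, h₁, h₂⟩) }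

/-! ### Conjugation -/

theorem sum_card_filter_lt (p : n.Partition) :
    ((Multiset.range n).map fun j => (p.parts.filter (j < ·)).card).sum = n := by
  have key : ∀ s : Multiset ℕ, (∀ x ∈ s, x ≤ n) →
      ∑ j ∈ Finset.range n, (s.filter (j < ·)).card = s.sum := by
    intro s
    induction s using Multiset.induction with
    | empty => simp
    | cons a s ih =>
      intro hs
      have ha : a ≤ n := hs a (Multiset.mem_cons_self a s)
      have h1 : ∑ j ∈ Finset.range n, (if j < a then 1 else 0) = a := by
        rw [← Finset.card_filter]
        have : (Finset.range n).filter (· < a) = Finset.range a := by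
          ext x
          simp only [Finset.mem_filter, Finset.mem_range]
          omega
        rw [this, Finset.card_range]
      rw [Multiset.sum_cons, ← ih fun x hx => hs x (Multiset.mem_cons_of_mem hx)]
      conv_rhs => rw [← h1]
      rw [← Finset.sum_add_distrib]
      refine Finset.sum_congr rfl fun j _ => ?_
      by_cases hj : j < a
      · rw [Multiset.filter_cons_of_pos _ hj, Multiset.card_cons, if_pos hj, add_comm]
      · rw [Multiset.filter_cons_of_neg _ hj, if_neg hj, zero_add]
  exact (key p.parts fun x hx => le_of_mem_parts hx).trans p.parts_sum

/-- The conjugate partition (reflection of the Ferrers diagram in its diagonal): its `j`-th part is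
the number of parts of `p` that are at least `j`, for `j = 1, …, n`, with zeros deleted. -/
def conj (p : n.Partition) : n.Partition :=
  ofSums n ((Multiset.range n).map fun j => (p.parts.filter (j < ·)).card) p.sum_card_filter_lt

end Nat.Partition

/-- The set `J(L)` of join-irreducible elements of a lattice. -/
def joinIrreducibles (L : Type*) [Lattice L] : Set L := {a | SupIrred a}

/-- The set `M(L)` of meet-irreducible elements of a lattice. -/
def meetIrreducibles (L : Type*) [Lattice L] : Set L := {a | InfIrred a}

namespace Nat.Partition

variable {n : ℕ}

/-! Conjugation reverses dominance, so it exchanges joins with meets and join- with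
meet-irreducibles; only the latter need counting. Meets are pointwise minima of partial sums. If two
boxes can be moved up over disjoint ranges of rows, the partition is the meet of the two results,
hence reducible (`nthPart_le_of_infIrred`). This forces the shape `(a, b, …, b, r)` with `r ≤ b`,
and excludes `(a, b, r)` with `a > b > r > 0`. Conversely, in the remaining non-maximal shapes some
single partial sum cannot stay fixed when the partition is properly raised, and such a partition is
irreducible (`infIrred_iff`). A meet-irreducible is thus determined by `(b, a)`. From `n` to `n +
1`, each `b` with `1 ≤ b ≤ n / 3` gains one pair, and `b = (n + 1) / 2` gains one more. -/

/-! ### Partitions as concave sequences of partial sums -/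

theorem exists_partialSum_eq (F : ℕ → ℕ) (h0 : F 0 = 0) (hmono : Monotone F)
    (hconc : ∀ i, F i + F (i + 2) ≤ 2 * F (i + 1)) (hn : ∀ j, n ≤ j → F j = n) :
    ∃ p : n.Partition, ∀ j, p.partialSum j = F j := by
  have hsum : ∀ j, ∑ i ∈ Finset.range j, (F (i + 1) - F i) = F j := fun j => by
    rw [Finset.sum_range_tsub hmono, h0, Nat.sub_zero]
  have hanti : Antitone fun i => F (i + 1) - F i := by
    refine antitone_nat_of_succ_le fun i => ?_
    have := hconc i
    have := hmono (Nat.le_succ i)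
    simp only [Nat.succ_eq_add_one, add_assoc, Nat.reduceAdd] at this ⊢
    omega
  refine ⟨ofFun n (fun i => F (i + 1) - F i) ((hsum n).trans (hn n le_rfl)), fun j => ?_⟩
  have hzero : F (n + 1) - F n = 0 := by
    rw [hn n le_rfl, hn (n + 1) (Nat.le_succ n), Nat.sub_self]
  rw [partialSum, Finset.sum_congr rfl fun i _ => nthPart_ofFun _ _ hanti hzero i]
  exact hsum j

theorem eq_of_partialSum_eq {p q : n.Partition} (h : ∀ j, p.partialSum j = q.partialSum j) :
    p = q :=
  le_antisymm (fun j => (h j).le) fun j => (h j).ge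

theorem partialSum_inf (p q : n.Partition) (j : ℕ) :
    (p ⊓ q).partialSum j = min (p.partialSum j) (q.partialSum j) :=
  (exists_partialSum_eq_min p q).choose_spec j

theorem partialSum_one (p : n.Partition) : p.partialSum 1 = p.nthPart 0 := by
  rw [partialSum_succ, partialSum_zero, zero_add]

theorem nthPart_eq_zero_of_le (p : n.Partition) {i : ℕ} (hi : p.parts.card ≤ i) :
    p.nthPart i = 0 := by
  have := p.nthPart_pos_iff i
  omega

theorem partialSum_card (p : n.Partition) {j : ℕ} (hj : p.parts.card ≤ j) :
    p.partialSum j = n := by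
  have hlen : (p.parts.sort (· ≥ ·)).length ≤ j := by rwa [Multiset.length_sort]
  rw [partialSum_eq_take, List.take_of_length_le hlen, ← Multiset.sum_coe, Multiset.sort_eq,
    p.parts_sum]

/-! ### Conjugation reverses the dominance ordering -/

theorem parts_eq_map_nthPart (p : n.Partition) :
    p.parts = (Multiset.range p.parts.card).map p.nthPart := by
  have h : p.parts.sort (· ≥ ·) = (List.range p.parts.card).map p.nthPart := by
    refine List.ext_getElem (by simp) fun i h₁ h₂ => ?_
    rw [List.getElem_map, List.getElem_range, nthPart, List.getD_eq_getElem _ _ h₁]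
  conv_lhs => rw [← Multiset.sort_eq p.parts (· ≥ ·), h]
  rfl

theorem lt_card_filter_lt_iff (p : n.Partition) (i j : ℕ) :
    j < (p.parts.filter (i < ·)).card ↔ i < p.nthPart j := by
  -- The parts exceeding `i` form an initial segment, whose length is the first index where the part
  -- is at most `i`.
  have hex : ∃ k, p.nthPart k ≤ i := ⟨p.parts.card, by simp [p.nthPart_eq_zero_of_le le_rfl]⟩
  have hiff : ∀ k, i < p.nthPart k ↔ k < Nat.find hex := fun k => by
    rw [Nat.lt_find_iff]
    exact ⟨fun h m hm => not_le.2 (h.trans_le (p.nthPart_antitone hm)),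
      fun h => not_le.1 (h k le_rfl)⟩
  have hle : Nat.find hex ≤ p.parts.card :=
    Nat.find_min' hex (by simp [p.nthPart_eq_zero_of_le le_rfl])
  have hcard : (p.parts.filter (i < ·)).card = Nat.find hex := by
    rw [p.parts_eq_map_nthPart, Multiset.filter_map, Multiset.card_map]
    change ((Finset.range p.parts.card).filter fun k => i < p.nthPart k).card = _
    rw [← Finset.card_range (Nat.find hex)]
    congr 1
    ext k
    rw [Finset.mem_filter, Finset.mem_range, Finset.mem_range, hiff]
    omega
  rw [hcard, hiff]

theorem nthPart_conj (p : n.Partition) (i : ℕ) :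
    p.conj.nthPart i = (p.parts.filter (i < ·)).card := by
  refine nthPart_ofFun (fun j => (p.parts.filter (j < ·)).card) p.sum_card_filter_lt ?_ ?_ i
  · exact fun a b hab => Multiset.card_le_card
      (Multiset.monotone_filter_right _ fun _ h => lt_of_le_of_lt hab h)
  · rw [Multiset.card_eq_zero, Multiset.filter_eq_nil]
    exact fun a ha => not_lt.2 (le_of_mem_parts ha)

theorem lt_nthPart_conj_iff (p : n.Partition) (i j : ℕ) :
    j < p.conj.nthPart i ↔ i < p.nthPart j := by
  rw [nthPart_conj, lt_card_filter_lt_iff]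

theorem conj_conj (p : n.Partition) : p.conj.conj = p :=
  nthPart_injective fun i => eq_of_forall_lt_iff fun j => by
    rw [lt_nthPart_conj_iff, lt_nthPart_conj_iff]

theorem nthPart_le (p : n.Partition) (i : ℕ) : p.nthPart i ≤ n :=
  le_add_self.trans ((p.partialSum_succ i).ge.trans (p.partialSum_le _))

theorem sum_ite_lt (m k : ℕ) : (∑ j ∈ Finset.range k, if j < m then 1 else 0) = min m k := by
  rw [← Finset.card_filter, ← Finset.card_range (min m k)]
  congr 1
  ext j
  simp only [Finset.mem_filter, Finset.mem_range]
  omega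

/-- The first `k` columns contain `min (p.nthPart i) k` boxes of row `i`; the truncated difference
counts the rest of that row. -/
theorem partialSum_conj_add (p : n.Partition) (k : ℕ) :
    p.conj.partialSum k + ∑ i ∈ Finset.range n, (p.nthPart i - k) = n := by
  have h : ∀ j, p.conj.nthPart j = ∑ i ∈ Finset.range n, if j < p.nthPart i then 1 else 0 :=
    fun j => by
      rw [Finset.sum_congr rfl fun i _ => if_congr (p.lt_nthPart_conj_iff j i).symm rfl rfl,
        sum_ite_lt, min_eq_left (p.conj.nthPart_le j)]
  rw [partialSum, Finset.sum_congr rfl fun j _ => h j, Finset.sum_comm, ← Finset.sum_add_distrib]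
  refine Eq.trans (Finset.sum_congr rfl fun i _ => ?_) (p.partialSum_of_le le_rfl)
  rw [sum_ite_lt]
  omega

/-- Let `s` be the number of parts of `p` exceeding `k`. The left side is exactly `p.partialSum s -
s * k`, while for `q` the same expression is only a lower bound, so dominance at the single index
`s` suffices. -/
theorem sum_nthPart_sub_le {p q : n.Partition} (h : p ≤ q) (k : ℕ) :
    ∑ i ∈ Finset.range n, (p.nthPart i - k) ≤ ∑ i ∈ Finset.range n, (q.nthPart i - k) := by
  set s := p.conj.nthPart k
  have hs : Finset.range s ⊆ Finset.range n := Finset.range_mono (p.conj.nthPart_le k)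
  have hp : ∑ i ∈ Finset.range s, (p.nthPart i - k) = ∑ i ∈ Finset.range n, (p.nthPart i - k) := by
    refine Finset.sum_subset hs fun i _ hi => ?_
    rw [Finset.mem_range, lt_nthPart_conj_iff] at hi
    omega
  have hadd : ∀ r : n.Partition, ∑ i ∈ Finset.range s, (r.nthPart i - k) + s * k =
      ∑ i ∈ Finset.range s, (r.nthPart i - k + k) := fun r => by
    rw [Finset.sum_add_distrib, Finset.sum_const, Finset.card_range, smul_eq_mul]
  have hp' : ∑ i ∈ Finset.range s, (p.nthPart i - k) + s * k = p.partialSum s := by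
    rw [hadd]
    refine Finset.sum_congr rfl fun i hi => ?_
    rw [Finset.mem_range, lt_nthPart_conj_iff] at hi
    omega
  have hq' : q.partialSum s ≤ ∑ i ∈ Finset.range s, (q.nthPart i - k) + s * k := by
    rw [hadd]
    exact Finset.sum_le_sum fun i _ => by omega
  have hq : ∑ i ∈ Finset.range s, (q.nthPart i - k) ≤ ∑ i ∈ Finset.range n, (q.nthPart i - k) :=
    Finset.sum_le_sum_of_subset hs
  have := h s
  omega

theorem conj_le_conj {p q : n.Partition} (h : p ≤ q) : q.conj ≤ p.conj := fun k => by
  have := p.partialSum_conj_add k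
  have := q.partialSum_conj_add k
  have := sum_nthPart_sub_le h k
  omega

theorem conj_le_conj_iff {p q : n.Partition} : p.conj ≤ q.conj ↔ q ≤ p :=
  ⟨fun h => by simpa only [conj_conj] using conj_le_conj h, conj_le_conj⟩

theorem conj_bijective : Function.Bijective (conj : n.Partition → n.Partition) :=
  Function.Involutive.bijective conj_conj

theorem conj_sup (p q : n.Partition) : (p ⊔ q).conj = p.conj ⊓ q.conj := by
  refine le_antisymm (le_inf (conj_le_conj le_sup_left) (conj_le_conj le_sup_right)) ?_
  rw [← conj_le_conj_iff, conj_conj]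
  refine sup_le ?_ ?_ <;> rw [← conj_le_conj_iff, conj_conj]
  exacts [inf_le_left, inf_le_right]

theorem supIrred_conj_iff {p : n.Partition} : SupIrred p.conj ↔ InfIrred p := by
  have hmax : IsMin p.conj ↔ IsMax p := by
    refine ⟨fun h q hq => conj_le_conj_iff.1 (h (conj_le_conj hq)), fun h q hq => ?_⟩
    rw [← q.conj_conj, conj_le_conj_iff] at hq ⊢
    exact h hq
  refine and_congr (not_congr hmax) ⟨fun h b c hbc => ?_, fun h b c hbc => ?_⟩
  · have := @h b.conj c.conj (conj_bijective.1
      (by rw [conj_sup, conj_conj, conj_conj, conj_conj, hbc]))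
    simpa only [conj_bijective.1.eq_iff] using this
  · have := @h b.conj c.conj (by rw [← conj_sup, hbc, conj_conj])
    exact this.imp (fun h => by rw [← h, conj_conj]) fun h => by rw [← h, conj_conj]

theorem ncard_joinIrreducibles_eq (n : ℕ) :
    (joinIrreducibles n.Partition).ncard = (meetIrreducibles n.Partition).ncard := by
  have : joinIrreducibles n.Partition = conj '' meetIrreducibles n.Partition := by
    ext p
    refine ⟨fun h => ⟨p.conj, ?_, p.conj_conj⟩, ?_⟩
    · rw [← p.conj_conj] at h
      exact supIrred_conj_iff.1 h
    · rintro ⟨q, hq, rfl⟩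
      exact supIrred_conj_iff.2 hq
  rw [this, Set.ncard_image_of_injective _ conj_bijective.1]

/-! ### Meet-irreducible partitions -/

theorem partialSum_succ_le (p : n.Partition) (j : ℕ) :
    p.partialSum (j + 1) ≤ min n (p.nthPart 0 + j * p.nthPart 1) := by
  refine le_min (p.partialSum_le _) ?_
  induction j with
  | zero => simp [partialSum_one]
  | succ j ih =>
    rw [partialSum_succ, add_one_mul, ← add_assoc]
    exact add_le_add ih (p.nthPart_antitone (by omega))

/-- Moving a box from row `j` up to row `i` raises the partial sums with index in `(i, j]`
by one. -/
theorem exists_raise (p : n.Partition) {i j : ℕ} (hij : i < j)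
    (hi : ∀ k, k + 1 = i → p.nthPart i < p.nthPart k) (hj : p.nthPart (j + 1) < p.nthPart j) :
    ∃ q : n.Partition, ∀ t, q.partialSum t = p.partialSum t + if i < t ∧ t ≤ j then 1 else 0 := by
  have hjn : j < n := ((p.nthPart_pos_iff j).1 (by omega)).trans_le p.card_parts_le
  refine exists_partialSum_eq _ (by simp [partialSum_zero]) ?_ ?_ ?_
  · refine monotone_nat_of_le_succ fun t => ?_
    rw [partialSum_succ]
    rcases eq_or_ne t j with rfl | ht
    · split_ifs <;> omega
    · split_ifs <;> omega
  · intro t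
    have ht := p.nthPart_antitone (Nat.le_succ t)
    rw [Nat.succ_eq_add_one] at ht
    simp only [show t + 2 = t + 1 + 1 from rfl, partialSum_succ]
    have h₁ := hi t
    rcases eq_or_ne (t + 1) i with rfl | h₂
    · have := h₁ rfl
      split_ifs <;> omega
    · rcases eq_or_ne t j with rfl | h₃
      · split_ifs <;> omega
      · split_ifs <;> omega
  · intro t ht
    rw [p.partialSum_of_le ht, if_neg (by omega), add_zero]

theorem isMax_of_nthPart_one_eq_zero {p : n.Partition} (h : p.nthPart 1 = 0) : IsMax p := by
  have hc : p.parts.card ≤ 1 := by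
    by_contra! hlt
    have := (p.nthPart_pos_iff 1).2 hlt
    omega
  intro q _ j
  rcases Nat.eq_zero_or_pos j with rfl | hj
  · rfl
  · rw [p.partialSum_card (hc.trans hj)]
    exact q.partialSum_le j

theorem not_isMax_of_nthPart_one_pos {p : n.Partition} (h : 0 < p.nthPart 1) : ¬ IsMax p := by
  intro hmax
  have hc : 1 < p.parts.card := (p.nthPart_pos_iff 1).1 h
  have hlast : 0 < p.nthPart (p.parts.card - 1) := (p.nthPart_pos_iff _).2 (by omega)
  -- Moving the last box of the bottom row to the top row gives a strictly larger partition.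
  obtain ⟨q, hq⟩ := p.exists_raise (i := 0) (j := p.parts.card - 1) (by omega) (by omega)
    (by rwa [p.nthPart_eq_zero_of_le (by omega)])
  have := hmax (b := q) (fun t => by rw [hq]; omega) 1
  rw [hq, if_pos (by omega)] at this
  omega

/-- The `j`-th partial sum of a meet is attained by one of its two members, and by hypothesis that
member is `p`. -/
theorem infIrred_of_forall_ge {p : n.Partition} (hp : ¬ IsMax p) (j : ℕ)
    (h : ∀ q, p ≤ q → q.partialSum j = p.partialSum j → q = p) : InfIrred p := by
  refine ⟨hp, fun b c hbc => ?_⟩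
  have hmin := partialSum_inf b c j
  rw [hbc] at hmin
  rcases min_choice (b.partialSum j) (c.partialSum j) with hb | hc
  · exact .inl (h b (hbc ▸ inf_le_left) (hb.symm.trans hmin.symm))
  · exact .inr (h c (hbc ▸ inf_le_right) (hc.symm.trans hmin.symm))

/-- Two box moves over disjoint ranges of rows exhibit `p` as a proper infimum. -/
theorem nthPart_le_of_infIrred {p : n.Partition} (hp : InfIrred p) {j k l : ℕ} (hj : 0 < j)
    (hjk : j ≤ k) (hkl : k < l) (h₁ : p.nthPart (j + 1) < p.nthPart j)
    (h₂ : p.nthPart k < p.nthPart (k - 1)) : p.nthPart l ≤ p.nthPart (l + 1) := by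
  by_contra! h₃
  obtain ⟨q, hq⟩ := p.exists_raise hj (by omega) h₁
  obtain ⟨r, hr⟩ := p.exists_raise hkl (fun m hm => by rwa [show m = k - 1 by omega]) h₃
  have hqr : q ⊓ r = p := eq_of_partialSum_eq fun t => by
    rw [partialSum_inf, hq, hr]
    split_ifs <;> omega
  rcases hp.2 hqr with rfl | rfl
  · have := hq j
    rw [if_pos (by omega)] at this
    omega
  · have := hr l
    rw [if_pos (by omega)] at this
    omega

theorem infIrred_iff {p : n.Partition} :
    InfIrred p ↔ 0 < p.nthPart 1 ∧
      (p.nthPart 0 + 2 * p.nthPart 1 ≤ n ∨ p.nthPart 0 + p.nthPart 1 = n ∨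
        p.nthPart 0 = p.nthPart 1) ∧
      ∀ j, p.partialSum (j + 1) = min n (p.nthPart 0 + j * p.nthPart 1) := by
  constructor
  · intro hp
    have hpos : 0 < p.nthPart 1 := by
      by_contra! h
      exact hp.1 (isMax_of_nthPart_one_eq_zero (by omega))
    obtain ⟨l, hl⟩ : ∃ l, p.parts.card = l + 2 := by
      have := (p.nthPart_pos_iff 1).1 hpos
      exact ⟨p.parts.card - 2, by omega⟩
    have hlast : p.nthPart (l + 1 + 1) < p.nthPart (l + 1) := by
      rw [p.nthPart_eq_zero_of_le (by omega)]
      exact (p.nthPart_pos_iff _).2 (by omega)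
    have hconst : ∀ j, j + 1 < l → p.nthPart (j + 2) = p.nthPart (j + 1) := by
      intro j hj
      refine le_antisymm (p.nthPart_antitone (Nat.le_succ _)) ?_
      by_contra! h
      -- One descent serves both moves: a box leaves the row above it for the top row, and a box of
      -- the last row moves to the row below it.
      exact (nthPart_le_of_infIrred hp (j := j + 1) (k := j + 2) (l := l + 1) (by omega) (by omega)
        (by omega) h h).not_gt hlast
    have hb : ∀ j, j < l → p.nthPart (j + 1) = p.nthPart 1 := by
      intro j
      induction j with
      | zero => intro; rfl
      | succ j ih => intro hj; rw [hconst j hj, ih (by omega)]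
    have hsum : ∀ j, j ≤ l → p.partialSum (j + 1) = p.nthPart 0 + j * p.nthPart 1 := by
      intro j
      induction j with
      | zero => intro; simp [partialSum_one]
      | succ j ih =>
        intro hj
        rw [partialSum_succ, ih (by omega), hb j (by omega)]
        ring
    have hn : p.partialSum (l + 1 + 1) = n := p.partialSum_card (by omega)
    refine ⟨hpos, ?_, fun j => ?_⟩
    · rcases Nat.lt_or_ge l 2 with hl2 | hl2
      · interval_cases l
        · have := hsum 0 le_rfl
          rw [partialSum_succ, this] at hn
          simp at hn
          omega
        · have h2 := hsum 1 le_rfl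
          have h01 := p.nthPart_antitone (show 0 ≤ 1 by omega)
          have h12 := p.nthPart_antitone (show 1 ≤ 2 by omega)
          rw [partialSum_succ, h2] at hn
          by_contra! h
          -- Here `p = (a, b, r)` with `a > b > r > 0`: a box can move from the second row to the
          -- first, or from the third to the second.
          exact (nthPart_le_of_infIrred hp (j := 1) (k := 1) (l := 2) (by omega) le_rfl (by omega)
            (by simp at hn ⊢; omega) (by simp; omega)).not_gt hlast
      · left
        rw [← hsum 2 hl2]
        exact p.partialSum_le _
    · rcases Nat.lt_or_ge l j with hj | hj
      · have h := (hn.symm.le.trans (p.partialSum_mono (show l + 1 + 1 ≤ j + 1 by omega)))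
        have h' := p.partialSum_succ_le j
        exact le_antisymm h' ((min_le_left _ _).trans h)
      · rw [hsum j hj, min_eq_right]
        rw [← hsum j hj]
        exact p.partialSum_le _
  · rintro ⟨hpos, hcase, hsum⟩
    -- The partial sums of `p` are the largest that its first two parts permit, so only those two
    -- parts need to be compared.
    have key : ∀ q, p ≤ q → q.nthPart 0 ≤ p.nthPart 0 → q.nthPart 1 ≤ p.nthPart 1 → q = p := by
      intro q hpq h0 h1
      refine le_antisymm (fun j => ?_) hpq
      rcases j with _ | j
      · rfl
      · rw [hsum]
        refine (q.partialSum_succ_le j).trans (min_le_min le_rfl ?_)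
        gcongr
    have hmax := not_isMax_of_nthPart_one_pos hpos
    by_cases h2 : p.nthPart 0 + 2 * p.nthPart 1 ≤ n
    -- The third part of `p` equals the second. With the second partial sum fixed, `p ≤ q` at index
    -- 3 bounds the third part of `q` below by it, hence also the second part, and so bounds the
    -- first above.
    · refine infIrred_of_forall_ge hmax 2 fun q hpq hq => ?_
      have e1 := hpq 1
      have e3 := hpq 3
      have h3 := hsum 2
      have h2' := hsum 1
      have h12 := q.nthPart_antitone (show 1 ≤ 2 by omega)
      rw [show 3 = 2 + 1 from rfl, h3, partialSum_succ q, hq] at e3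
      rw [partialSum_succ q 1, partialSum_one] at hq
      rw [partialSum_one, partialSum_one] at e1
      rw [show 1 + 1 = 2 from rfl] at h2'
      refine key q hpq ?_ ?_ <;> omega
    -- With the first part fixed, the second cannot grow: either the first two already sum to `n`,
    -- or they are equal.
    · refine infIrred_of_forall_ge hmax 1 fun q hpq hq => ?_
      rw [partialSum_one, partialSum_one] at hq
      have h01 := q.nthPart_antitone (show 0 ≤ 1 by omega)
      have e2 := q.partialSum_le 2
      rw [partialSum_succ q 1, partialSum_one] at e2
      refine key q hpq hq.le ?_
      omega

/-! ### Counting -/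

/-- The pairs formed by the two largest parts of a meet-irreducible partition of `n`, listed as
(second part, largest part). -/
def meetIrreduciblePairs (n : ℕ) : Finset (ℕ × ℕ) :=
  (Finset.range (n + 1) ×ˢ Finset.range (n + 1)).filter fun x =>
    0 < x.1 ∧ x.1 ≤ x.2 ∧ x.1 + x.2 ≤ n ∧ (x.2 + 2 * x.1 ≤ n ∨ x.2 + x.1 = n ∨ x.2 = x.1)

theorem ncard_meetIrreducibles (n : ℕ) :
    (meetIrreducibles n.Partition).ncard = (meetIrreduciblePairs n).card := by
  have himage : (fun p : n.Partition => (p.nthPart 1, p.nthPart 0)) '' meetIrreducibles n.Partition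
      = meetIrreduciblePairs n := by
    ext ⟨b, a⟩
    simp only [Set.mem_image, meetIrreduciblePairs, Finset.coe_filter, Finset.mem_product,
      Finset.mem_range, Set.mem_ofPred_eq, Prod.mk.injEq]
    constructor
    · rintro ⟨p, hp, rfl, rfl⟩
      obtain ⟨hpos, hcase, -⟩ := infIrred_iff.1 hp
      have h01 := p.nthPart_antitone (show 0 ≤ 1 by omega)
      have h2 := p.partialSum_le 2
      rw [partialSum_succ p 1, partialSum_one] at h2
      omega
    · rintro ⟨-, hb, hba, hn, hcase⟩
      -- Capping `a + j * b` at `n` keeps the sequence concave and produces the last part `r`; as `a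
      -- + b ≤ n`, the cap leaves the first two parts intact.
      have hF : ∃ p : n.Partition, ∀ j, p.partialSum j =
          (j.casesOn 0 fun j => min n (a + j * b) : ℕ) := by
        refine exists_partialSum_eq _ rfl (monotone_nat_of_le_succ fun j => ?_) ?_ ?_
        · rcases j with _ | j
          · exact Nat.zero_le _
          · exact min_le_min le_rfl (by gcongr; omega)
        · rintro (_ | j)
          · change 0 + min n (a + (0 + 1) * b) ≤ 2 * min n (a + 0 * b)
            omega
          · simp only [add_mul]
            omega
        · rintro (_ | j) hj
          · omega
          · have : j ≤ j * b := Nat.le_mul_of_pos_right j hb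
            simp only
            omega
      obtain ⟨p, hp⟩ := hF
      have h1 : p.partialSum 1 = min n (a + 0 * b) := hp 1
      have h2 : p.partialSum 2 = min n (a + 1 * b) := hp 2
      rw [partialSum_succ p 1] at h2
      rw [partialSum_one] at h1 h2
      have e0 : p.nthPart 0 = a := by omega
      have e1 : p.nthPart 1 = b := by omega
      refine ⟨p, infIrred_iff.2 ?_, e1, e0⟩
      rw [e0, e1]
      exact ⟨hb, hcase, fun j => hp (j + 1)⟩
  rw [← Set.ncard_coe_finset, ← himage, Set.InjOn.ncard_image]
  intro p hp q hq hpq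
  obtain ⟨h1, h0⟩ := Prod.mk.inj hpq
  refine eq_of_partialSum_eq fun j => ?_
  rcases j with _ | j
  · rfl
  · rw [(infIrred_iff.1 hp).2.2, (infIrred_iff.1 hq).2.2, h0, h1]

/-- For fixed `b > 0`, the terms count `a` in `[b, n - 2 * b]`, then `a = n - b`, then `a = b` when
neither of the others covers it. -/
theorem card_meetIrreduciblePairs (n : ℕ) :
    (meetIrreduciblePairs n).card = ∑ b ∈ Finset.range (n + 1),
      if b = 0 then 0 else (n + 1 - 3 * b) + (if 2 * b ≤ n then 1 else 0) +
        (if 2 * b < n ∧ n < 3 * b then 1 else 0) := by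
  rw [meetIrreduciblePairs, Finset.card_filter, Finset.sum_product]
  refine Finset.sum_congr rfl fun b _ => ?_
  rw [← Finset.card_filter]
  rcases Nat.eq_zero_or_pos b with rfl | hb
  · simp
  rw [if_neg hb.ne']
  rcases le_or_gt (3 * b) n with h3 | h3
  · trans (insert (n - b) (Finset.Icc b (n - 2 * b))).card
    · congr 1
      ext a
      simp only [Finset.mem_filter, Finset.mem_range, Finset.mem_insert, Finset.mem_Icc]
      omega
    · rw [Finset.card_insert_of_notMem (by rw [Finset.mem_Icc]; omega), Nat.card_Icc]
      split_ifs <;> omega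
  rcases lt_trichotomy (2 * b) n with h2 | h2 | h2
  · trans ({b, n - b} : Finset ℕ).card
    · congr 1
      ext a
      simp only [Finset.mem_filter, Finset.mem_range, Finset.mem_insert, Finset.mem_singleton]
      omega
    · rw [Finset.card_pair (by omega)]
      split_ifs <;> omega
  · trans ({b} : Finset ℕ).card
    · congr 1
      ext a
      simp only [Finset.mem_filter, Finset.mem_range, Finset.mem_singleton]
      omega
    · rw [Finset.card_singleton]
      split_ifs <;> omega
  · trans (∅ : Finset ℕ).card
    · congr 1
      ext a
      simp only [Finset.mem_filter, Finset.mem_range, Finset.notMem_empty, iff_false]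
      omega
    · rw [Finset.card_empty]
      split_ifs <;> omega

theorem card_meetIrreduciblePairs_succ (n : ℕ) (hn : 1 ≤ n) :
    (meetIrreduciblePairs (n + 1)).card = (meetIrreduciblePairs n).card + n / 3 + 1 := by
  rw [card_meetIrreduciblePairs, card_meetIrreduciblePairs]
  set t : ℕ → ℕ → ℕ := fun n b => if b = 0 then 0 else (n + 1 - 3 * b) +
    (if 2 * b ≤ n then 1 else 0) + (if 2 * b < n ∧ n < 3 * b then 1 else 0) with ht
  change ∑ b ∈ Finset.range (n + 1 + 1), t (n + 1) b =
    ∑ b ∈ Finset.range (n + 1), t n b + n / 3 + 1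
  -- At `3 * b = n + 1` the interval gains a point, but for `n > 2` it is the pair `a = b` counted
  -- before. The extra gain at `(n + 1) / 2` is generally `a = n + 1 - b` for odd `n` and `a = b`
  -- for even `n`.
  have hstep : ∀ b, t (n + 1) b =
      t n b + (if b ∈ Finset.Icc 1 (n / 3) then 1 else 0) + if b = (n + 1) / 2 then 1 else 0 := by
    intro b
    simp only [ht, Finset.mem_Icc]
    split_ifs <;> omega
  have hthird : ∑ b ∈ Finset.range (n + 1), (if b ∈ Finset.Icc 1 (n / 3) then 1 else 0) =
      n / 3 := by
    rw [← Finset.card_filter, Finset.filter_mem_eq_inter, Finset.inter_eq_right.2, Nat.card_Icc,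
      Nat.add_sub_cancel]
    intro b hb
    rw [Finset.mem_Icc] at hb
    rw [Finset.mem_range]
    omega
  have hhalf : ∑ b ∈ Finset.range (n + 1), (if b = (n + 1) / 2 then 1 else 0) = 1 := by
    rw [Finset.sum_ite_eq', if_pos (by rw [Finset.mem_range]; omega)]
  have hlast : t (n + 1) (n + 1) = 0 := by
    simp only [ht]
    split_ifs <;> omega
  rw [Finset.sum_range_succ, hlast, add_zero, Finset.sum_congr rfl fun b _ => hstep b,
    Finset.sum_add_distrib, Finset.sum_add_distrib, hthird, hhalf]

theorem ncard_meetIrreducibles_succ (n : ℕ) (hn : 1 ≤ n) :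
    (meetIrreducibles (n + 1).Partition).ncard =
      (meetIrreducibles n.Partition).ncard + n / 3 + 1 := by
  simp only [ncard_meetIrreducibles, card_meetIrreduciblePairs_succ n hn]

theorem ncard_meetIrreducibles_one : (meetIrreducibles (Nat.Partition 1)).ncard = 0 := by
  rw [ncard_meetIrreducibles]
  decide

end Nat.Partition

theorem mainTheorem1 :
    ((joinIrreducibles (Nat.Partition 1)).ncard = 0 ∧
      ∀ n : ℕ, 1 ≤ n →
        (joinIrreducibles (Nat.Partition (n + 1))).ncard =
          (joinIrreducibles (Nat.Partition n)).ncard + n / 3 + 1) ∧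
    (∀ n : ℕ, 1 ≤ n →
      Function.Bijective (Nat.Partition.conj : n.Partition → n.Partition) ∧
      ∀ p q : n.Partition, p.conj ≤ q.conj ↔ q ≤ p) ∧
    ((meetIrreducibles (Nat.Partition 1)).ncard = 0 ∧
      ∀ n : ℕ, 1 ≤ n →
        (meetIrreducibles (Nat.Partition (n + 1))).ncard =
          (meetIrreducibles (Nat.Partition n)).ncard + n / 3 + 1) := by
  refine ⟨⟨?_, fun n hn => ?_⟩, fun n _ => ⟨Nat.Partition.conj_bijective, fun p q =>
    Nat.Partition.conj_le_conj_iff⟩, Nat.Partition.ncard_meetIrreducibles_one,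
    Nat.Partition.ncard_meetIrreducibles_succ⟩
  · rw [Nat.Partition.ncard_joinIrreducibles_eq, Nat.Partition.ncard_meetIrreducibles_one]
  · rw [Nat.Partition.ncard_joinIrreducibles_eq, Nat.Partition.ncard_joinIrreducibles_eq,
      Nat.Partition.ncard_meetIrreducibles_succ n hn]
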